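/- Let $n,m,N,M,T$ be dimensions, let $x\mapsto Z(x)\in\mathbb R^N$ and $x\mapsto W(x)\in\mathbb R^{M\times m}$ be a vector and a matrix of known real polynomials in $x\in\mathbb R^n$ (for instance, regressors of monomials), and consider the system $\dot x=A_\star Z(x)+B_\star W(x)u+d$ with unknown $A_\star\in\mathbb R^{n\times N}$, $B_\star\in\mathbb R^{n\times M}$, input $u\in\mathbb R^m$ and disturbance $d\in\mathbb R^n$. Suppose that samples $x(t_i),u(t_i),\dot x(t_i),d(t_i)$, $i=0,\dots,T-1$, satisfy this equation, and set $$X_1=[\dot x(t_0)\ \cdots\ \dot x(t_{T-1})],\quad Z_0=[Z(x(t_0))\ \cdots\ Z(x(t_{T-1}))],$$ $$V_0=[W(x(t_0))u(t_0)\ \cdots\ W(x(t_{T-1}))u(t_{T-1})],\quad D_0=[d(t_0)\ \cdots\ d(t_{T-1})].$$ For a given matrix $\Delta$ with $n$ rows let $\mathcal D=\{D\in\mathbb R^{n\times T}: DD^\top\preceq\Delta\Delta^\top\}$, suppose $D_0\in\mathcal D$, and let $$\tilde{\mathcal C}=\{(A,B): X_1=AZ_0+BV_0+D\ \text{for some }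 D\in\mathcal D\}.$$ Assume that $\begin{bmatrix}Z_0\\V_0\end{bmatrix}$ has full row rank, and put $$\tilde A=\begin{bmatrix}Z_0\\V_0\end{bmatrix}\begin{bmatrix}Z_0\\V_0\end{bmatrix}^\top,\quad \tilde B=-\begin{bmatrix}Z_0\\V_0\end{bmatrix}X_1^\top,\quad \tilde C=X_1X_1^\top-\Delta\Delta^\top,$$ $$\tilde Z_c=-\tilde A^{-1}\tilde B,\quad \tilde Q=\tilde B^\top\tilde A^{-1}\tilde B-\tilde C .$$ Let $\ell_1,\ell_2$ be positive definite polynomials on $\mathbb R^n$ (zero at zero and positive elsewhere) with $\ell_1(x)\to+\infty$ as $|x|\to+\infty$, and let $\epsilon_\lambda>0$. Suppose there exist polynomials $V,\lambda$ (scalar) and $k$ ($\mathbb R^m$-valued) with $V(0)=0$ and $k(0)=0$ such that, with $$\mathcal M=\begin{bmatrix}\ell_2+\frac{\partial V}{\partial x}\tilde Z_c^\top y & y^\top\tilde A^{-1/2} & \lambda\frac{\partial V}{\partial x}\tilde Q^{1/2}\\ \tilde A^{-1/2}y & -\lambda I & 0\\ \lambda\tilde Q^{1/2}\frac{\partial V}{\partial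 x}^\top & 0 & -4\lambda I\end{bmatrix},\qquad y=\begin{bmatrix}Z\\Wk\end{bmatrix},$$ $V-\ell_1$ and $\lambda-\epsilon_\lambda$ are sums of squares of polynomials, and $-\mathcal M$ is a sum-of-squares matrix polynomial, i.e. a finite sum $\sum_i F_i^\top F_i$ with $F_i$ matrix polynomials. Then: (a) for each $x\in\mathbb R^n$, $V(x)-\ell_1(x)\ge 0$, $\mathcal M(x)\preceq 0$ and $\lambda(x)>0$; (b) for all $(A,B)\in\tilde{\mathcal C}$ the origin of $\dot x=AZ(x)+BW(x)k(x)$ is globally asymptotically stable, i.e. it is an equilibrium, from every initial state there is a solution on $[0,\infty)$, the origin is Lyapunov stable, and every solution converges to it; (c) in particular, $(A_\star,B_\star)\in\tilde{\mathcal C}$ and the origin of $\dot x=A_\star Z(x)+B_\star W(x)k(x)$ is globally asymptotically stable. -/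

import Mathlib

open Matrix MvPolynomial Filter Topology
open scoped MatrixOrder

noncomputable section

/-- Real polynomials in `n` variables. -/
abbrev RPoly (n : ℕ) := MvPolynomial (Fin n) ℝ

/-! ### Evaluation and polynomial notions -/

/-- Value at `x` of a vector of polynomials. -/
def evalVec {n p : ℕ} (x : Fin n → ℝ) (Z : Fin p → RPoly n) : Fin p → ℝ :=
  fun i => eval x (Z i)

/-- Value at `x` of a matrix of polynomials. -/
def evalMat {n p r : ℕ} (x : Fin n → ℝ) (W : Matrix (Fin p) (Fin r) (RPoly n)) :
    Matrix (Fin p) (Fin r) ℝ :=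
  W.map (eval x)

/-- The gradient `∂V/∂x` as a vector of polynomials. -/
def gradPoly {n : ℕ} (V : RPoly n) : Fin n → RPoly n :=
  fun i => pderiv i V

/-- Positive definite polynomial: zero at zero and positive elsewhere. -/
def IsPosDefPoly {n : ℕ} (p : RPoly n) : Prop :=
  eval 0 p = 0 ∧ ∀ x : Fin n → ℝ, x ≠ 0 → 0 < eval x p

/-- Radially unbounded polynomial: `p x → +∞` as `|x| → +∞`. -/
def IsRadiallyUnbounded {n : ℕ} (p : RPoly n) : Prop :=
  Tendsto (fun x : EuclideanSpace ℝ (Fin n) => eval x.ofLp p)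
    (comap (fun x => ‖x‖) atTop) atTop

/-- Sum-of-squares matrix polynomial: a finite sum of `Fᵀ F` with matrix polynomials `F`. -/
def IsSOSMatrix {n : ℕ} {ι : Type*} [Fintype ι] (P : Matrix ι ι (RPoly n)) : Prop :=
  ∃ (s : ℕ) (F : Fin s → Matrix ι ι (RPoly n)), P = ∑ i, (F i)ᵀ * F i

/-! ### Data -/

/-- The matrix whose columns are the samples `v 0, …, v (T-1)`. -/
def snapshots {p T : ℕ} (v : Fin T → Fin p → ℝ) : Matrix (Fin p) (Fin T) ℝ :=
  Matrix.of fun i t => v t i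

/-- The matrix `Z₀` with columns `Z(x(tᵢ))`. -/
def dataZ {n N T : ℕ} (Z : Fin N → RPoly n) (xs : Fin T → Fin n → ℝ) :
    Matrix (Fin N) (Fin T) ℝ :=
  snapshots fun t => evalVec (xs t) Z

/-- The matrix `V₀` with columns `W(x(tᵢ)) u(tᵢ)`. -/
def dataV {n m M T : ℕ} (W : Matrix (Fin M) (Fin m) (RPoly n)) (xs : Fin T → Fin n → ℝ)
    (us : Fin T → Fin m → ℝ) : Matrix (Fin M) (Fin T) ℝ :=
  snapshots fun t => evalMat (xs t) W *ᵥ us t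

/-- The disturbance model: matrices `D` with `D Dᵀ ≼ Δ Δᵀ`. -/
def disturbanceSet {n q : ℕ} (T : ℕ) (Δ : Matrix (Fin n) (Fin q) ℝ) :
    Set (Matrix (Fin n) (Fin T) ℝ) :=
  {D | (Δ * Δᵀ - D * Dᵀ).PosSemidef}

/-- The set of pairs `(A, B)` consistent with the data `X₁`, `Z₀`, `V₀` and the disturbance
model. -/
def consistentSet {n N M T q : ℕ} (X1 : Matrix (Fin n) (Fin T) ℝ)
    (Z0 : Matrix (Fin N) (Fin T) ℝ) (V0 : Matrix (Fin M) (Fin T) ℝ)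
    (Δ : Matrix (Fin n) (Fin q) ℝ) :
    Set (Matrix (Fin n) (Fin N) ℝ × Matrix (Fin n) (Fin M) ℝ) :=
  {AB | ∃ D ∈ disturbanceSet T Δ, X1 = AB.1 * Z0 + AB.2 * V0 + D}

/-- `Ã = [Z₀; V₀] [Z₀; V₀]ᵀ`. -/
def matA {N M T : ℕ} (Z0 : Matrix (Fin N) (Fin T) ℝ) (V0 : Matrix (Fin M) (Fin T) ℝ) :
    Matrix (Fin N ⊕ Fin M) (Fin N ⊕ Fin M) ℝ :=
  fromRows Z0 V0 * (fromRows Z0 V0)ᵀ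

/-- `B̃ = -[Z₀; V₀] X₁ᵀ`. -/
def matB {n N M T : ℕ} (X1 : Matrix (Fin n) (Fin T) ℝ) (Z0 : Matrix (Fin N) (Fin T) ℝ)
    (V0 : Matrix (Fin M) (Fin T) ℝ) : Matrix (Fin N ⊕ Fin M) (Fin n) ℝ :=
  -(fromRows Z0 V0 * X1ᵀ)

/-- `C̃ = X₁ X₁ᵀ - Δ Δᵀ`. -/
def matC {n T q : ℕ} (X1 : Matrix (Fin n) (Fin T) ℝ) (Δ : Matrix (Fin n) (Fin q) ℝ) :
    Matrix (Fin n) (Fin n) ℝ :=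
  X1 * X1ᵀ - Δ * Δᵀ

/-- The centre `Z̃c = -Ã⁻¹ B̃`. -/
def matZc {n N M T : ℕ} (X1 : Matrix (Fin n) (Fin T) ℝ) (Z0 : Matrix (Fin N) (Fin T) ℝ)
    (V0 : Matrix (Fin M) (Fin T) ℝ) : Matrix (Fin N ⊕ Fin M) (Fin n) ℝ :=
  -((matA Z0 V0)⁻¹ * matB X1 Z0 V0)

/-- `Q̃ = B̃ᵀ Ã⁻¹ B̃ - C̃`. -/
def matQ {n N M T q : ℕ} (X1 : Matrix (Fin n) (Fin T) ℝ) (Z0 : Matrix (Fin N) (Fin T) ℝ)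
    (V0 : Matrix (Fin M) (Fin T) ℝ) (Δ : Matrix (Fin n) (Fin q) ℝ) :
    Matrix (Fin n) (Fin n) ℝ :=
  (matB X1 Z0 V0)ᵀ * (matA Z0 V0)⁻¹ * matB X1 Z0 V0 - matC X1 Δ

/-- `Ã^{-1/2}`, the positive semidefinite root of `Ã⁻¹`. -/
def matAinvSqrt {N M T : ℕ} (Z0 : Matrix (Fin N) (Fin T) ℝ) (V0 : Matrix (Fin M) (Fin T) ℝ) :
    Matrix (Fin N ⊕ Fin M) (Fin N ⊕ Fin M) ℝ :=
  CFC.sqrt (matA Z0 V0)⁻¹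

/-- `Q̃^{1/2}`, the positive semidefinite root of `Q̃`. -/
def matQSqrt {n N M T q : ℕ} (X1 : Matrix (Fin n) (Fin T) ℝ) (Z0 : Matrix (Fin N) (Fin T) ℝ)
    (V0 : Matrix (Fin M) (Fin T) ℝ) (Δ : Matrix (Fin n) (Fin q) ℝ) :
    Matrix (Fin n) (Fin n) ℝ :=
  CFC.sqrt (matQ X1 Z0 V0 Δ)

/-! ### The decrease matrix -/

/-- The symmetric block matrix
`[[l + g Zcᵀ y, ⋆, ⋆], [Ah y, -μ I, ⋆], [μ Qh gᵀ, 0, -4 μ I]]` over a commutative ring. -/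
def decreaseBlock {R ι κ : Type*} [CommRing R] [Fintype ι] [DecidableEq ι] [Fintype κ]
    [DecidableEq κ] (Ah : Matrix κ κ R) (Qh : Matrix ι ι R) (Zc : Matrix κ ι R)
    (l μ : R) (g : ι → R) (y : κ → R) : Matrix (Unit ⊕ (κ ⊕ ι)) (Unit ⊕ (κ ⊕ ι)) R :=
  let col : Matrix (κ ⊕ ι) Unit R :=
    fromRows (replicateCol Unit (Ah *ᵥ y)) (replicateCol Unit (μ • (Qh *ᵥ g)))
  fromBlocks (Matrix.of fun _ _ => l + g ⬝ᵥ (Zcᵀ *ᵥ y)) colᵀ col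
    (fromBlocks (-(μ • (1 : Matrix κ κ R))) 0 0 (-((4 * μ) • (1 : Matrix ι ι R))))

/-- The decrease matrix as a matrix polynomial. -/
def decreasePoly {n m N M : ℕ} (Ah : Matrix (Fin N ⊕ Fin M) (Fin N ⊕ Fin M) ℝ)
    (Qh : Matrix (Fin n) (Fin n) ℝ) (Zc : Matrix (Fin N ⊕ Fin M) (Fin n) ℝ)
    (Z : Fin N → RPoly n) (W : Matrix (Fin M) (Fin m) (RPoly n))
    (l V lam : RPoly n) (k : Fin m → RPoly n) :
    Matrix (Unit ⊕ ((Fin N ⊕ Fin M) ⊕ Fin n)) (Unit ⊕ ((Fin N ⊕ Fin M) ⊕ Fin n)) (RPoly n) :=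
  decreaseBlock (Ah.map C) (Qh.map C) (Zc.map C) l lam (gradPoly V) (Sum.elim Z (W *ᵥ k))

/-- The decrease matrix at the point `x`. -/
def decreaseAt {n m N M : ℕ} (Ah : Matrix (Fin N ⊕ Fin M) (Fin N ⊕ Fin M) ℝ)
    (Qh : Matrix (Fin n) (Fin n) ℝ) (Zc : Matrix (Fin N ⊕ Fin M) (Fin n) ℝ)
    (Z : Fin N → RPoly n) (W : Matrix (Fin M) (Fin m) (RPoly n))
    (l V lam : RPoly n) (k : Fin m → RPoly n) (x : Fin n → ℝ) :
    Matrix (Unit ⊕ ((Fin N ⊕ Fin M) ⊕ Fin n)) (Unit ⊕ ((Fin N ⊕ Fin M) ⊕ Fin n)) ℝ :=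
  decreaseBlock Ah Qh Zc (eval x l) (eval x lam) (evalVec x (gradPoly V))
    (Sum.elim (evalVec x Z) (evalMat x W *ᵥ evalVec x k))

/-! ### Closed loop and global asymptotic stability -/

/-- The closed-loop vector field `f(x) = A Z(x) + B W(x) k(x)`. -/
def closedLoop {n m N M : ℕ} (Z : Fin N → RPoly n) (W : Matrix (Fin M) (Fin m) (RPoly n))
    (k : Fin m → RPoly n) (A : Matrix (Fin n) (Fin N) ℝ) (B : Matrix (Fin n) (Fin M) ℝ)
    (x : EuclideanSpace ℝ (Fin n)) : EuclideanSpace ℝ (Fin n) :=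
  WithLp.toLp 2 (A *ᵥ evalVec x.ofLp Z + B *ᵥ (evalMat x.ofLp W *ᵥ evalVec x.ofLp k))

/-- `φ` is a solution of `ẋ = f(x)` on `[0, ∞)`. -/
def IsForwardSolution {E : Type*} [NormedAddCommGroup E] [NormedSpace ℝ E] (f : E → E)
    (φ : ℝ → E) : Prop :=
  IsIntegralCurveOn φ (fun _ => f) (Set.Ici 0)

/-- The origin is a globally asymptotically stable equilibrium of `ẋ = f(x)`: it is an equilibrium,
a solution on `[0, ∞)` exists from every initial state, the origin is Lyapunov stable, and every
solution converges to it. -/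
structure IsGloballyAsymptoticallyStable {E : Type*} [NormedAddCommGroup E] [NormedSpace ℝ E]
    (f : E → E) : Prop where
  equilibrium : f 0 = 0
  complete : ∀ x₀ : E, ∃ φ : ℝ → E, IsForwardSolution f φ ∧ φ 0 = x₀
  stable : ∀ ε > 0, ∃ δ > 0, ∀ φ : ℝ → E, IsForwardSolution f φ → ‖φ 0‖ < δ →
    ∀ t ≥ 0, ‖φ t‖ < ε
  attractive : ∀ φ : ℝ → E, IsForwardSolution f φ → Tendsto φ atTop (𝓝 0)

end

/-!
The polynomial `V` is a common Lyapunov function for all closed loops that are consistent with the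
data; the two ingredients are a matrix completion of squares and Lyapunov's direct method.

*Robust decrease.* With `ζ = [A B]ᵀ`, consistency of `(A, B)` with the data says that
`(ζ - Z̃c)ᵀ Ã (ζ - Z̃c) ≼ Q̃` (`matQ_eq_add`); since `Ã ≻ 0` by the rank condition and since a
consistent pair exists, `Q̃` is positive semidefinite and both square roots are genuine. Writing
`E = ζ - Z̃c`, the derivative of `V` along the closed loop is `g ⬝ Z̃cᵀ y + g ⬝ Eᵀ y` with
`g = ∂V/∂xᵀ`. Young's inequality with weight `λ(x) > 0` bounds the uncertain term by
`|Ã^{-1/2} y|² / λ + (λ / 4) |Q̃^{1/2} g|²` (`dotProduct_transpose_mulVec_le`), and the Schur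
complement of `𝓜(x) ≼ 0` bounds the sum of this and `g ⬝ Z̃cᵀ y` by `-ℓ₂`
(`add_le_zero_of_decreaseBlock`). Hence `V̇ ≤ -ℓ₂` (`decrease_of_mem_consistentSet`).

*Equilibrium.* As `V ≥ ℓ₁ ≥ 0 = V(0)`, the gradient of `V` vanishes at the origin, so the corner
entry of `𝓜(0)` is zero; semidefiniteness then forces `Ã^{-1/2} y(0) = 0`, hence `Z(0) = 0`
(`regressor_eq_zero`).

*Stability.* `V` is positive definite and radially unbounded because `V ≥ ℓ₁`, and `ℓ₂` is positive
definite, so Lyapunov's theorem applies (`isGloballyAsymptoticallyStable_of_lyapunov`). Existence of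
solutions on `[0, ∞)` is part of it: sublevel sets of `V` are compact and invariant, so the field
may be cut off outside a ball, and a bounded Lipschitz field has global solutions.
-/

/-! ### Global solutions of bounded Lipschitz vector fields -/

/-- Since the field is bounded, the Picard-Lindelöf theorem applies on `[0, b]` for every `b`; by
uniqueness the solutions on longer and longer intervals extend each other. -/
theorem exists_isForwardSolution_of_bounded_lipschitz {E : Type*} [NormedAddCommGroup E]
    [NormedSpace ℝ E] [CompleteSpace E] {g : E → E} {K : NNReal} (hK : LipschitzWith K g)
    {L : ℝ} (hL : ∀ x, ‖g x‖ ≤ L) (x₀ : E) :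
    ∃ φ : ℝ → E, IsForwardSolution g φ ∧ φ 0 = x₀ := by
  have hex : ∀ b : ℕ, ∃ α : ℝ → E, α 0 = x₀ ∧
      ∀ t ∈ Set.Icc (0 : ℝ) b, HasDerivWithinAt α (g (α t)) (Set.Icc (0 : ℝ) b) t := by
    intro b
    have hpl : IsPicardLindelof (fun _ => g) (tmin := 0) (tmax := (b : ℝ))
        ⟨0, le_rfl, Nat.cast_nonneg b⟩ x₀ (L.toNNReal * b) 0 L.toNNReal K :=
      { lipschitzOnWith := fun t _ => hK.lipschitzOnWith
        continuousOn := fun x _ => continuousOn_const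
        norm_le := fun t _ x _ => (hL x).trans (Real.le_coe_toNNReal L)
        mul_max_le := by simp }
    exact hpl.exists_eq_forall_mem_Icc_hasDerivWithinAt₀
  choose α hα0 hα using hex
  have hcont : ∀ b : ℕ, ContinuousOn (α b) (Set.Icc (0 : ℝ) b) :=
    fun b t ht => (hα b t ht).continuousWithinAt
  have hright : ∀ b : ℕ, ∀ t ∈ Set.Ico (0 : ℝ) b,
      HasDerivWithinAt (α b) (g (α b t)) (Set.Ici t) t := fun b t ht =>
    (hα b t (Set.Ico_subset_Icc_self ht)).mono_of_mem_nhdsWithin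
      (mem_of_superset (Icc_mem_nhdsGE ht.2) (Set.Icc_subset_Icc_left ht.1))
  have huniq : ∀ a b : ℕ, a ≤ b → Set.EqOn (α a) (α b) (Set.Icc (0 : ℝ) a) := by
    intro a b hab
    have hab' : (a : ℝ) ≤ b := Nat.cast_le.mpr hab
    exact ODE_solution_unique_of_mem_Icc_right (v := fun _ => g) (s := fun _ => Set.univ)
      (fun t _ => hK.lipschitzOnWith) (hcont a) (hright a) (fun _ _ => Set.mem_univ _)
      ((hcont b).mono (Set.Icc_subset_Icc_right hab'))
      (fun t ht => hright b t ⟨ht.1, ht.2.trans_le hab'⟩) (fun _ _ => Set.mem_univ _)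
      ((hα0 a).trans (hα0 b).symm)
  have hglue : ∀ b : ℕ, ∀ t ∈ Set.Ico (0 : ℝ) b, α (⌊t⌋₊ + 1) t = α b t := by
    intro b t ht
    have h1 : ⌊t⌋₊ + 1 ≤ b := (Nat.floor_lt ht.1).2 ht.2
    exact huniq _ _ h1 ⟨ht.1, by push_cast; exact (Nat.lt_floor_add_one t).le⟩
  refine ⟨fun t => α (⌊t⌋₊ + 1) t, fun t ht => ?_, hα0 _⟩
  have ht0 : (0 : ℝ) ≤ t := ht
  have htb : t < ((⌊t⌋₊ + 1 : ℕ) : ℝ) := by push_cast; exact Nat.lt_floor_add_one t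
  have hmem : Set.Ico (0 : ℝ) ((⌊t⌋₊ + 1 : ℕ) : ℝ) ∈ 𝓝[Set.Ici 0] t := by
    rw [← Set.Ici_inter_Iio]
    exact inter_mem self_mem_nhdsWithin (mem_nhdsWithin_of_mem_nhds (Iio_mem_nhds htb))
  have hd := (hα (⌊t⌋₊ + 1) t ⟨ht0, htb.le⟩).mono_of_mem_nhdsWithin
    (mem_of_superset hmem Set.Ico_subset_Icc_self)
  exact hd.congr_of_eventuallyEq (mem_of_superset hmem (hglue _)) rfl

/-! ### Lyapunov's direct method -/

section Lyapunov

variable {E : Type*} [NormedAddCommGroup E] [NormedSpace ℝ E] {f : E → E} {φ : ℝ → E} {V : E → ℝ}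

theorem IsForwardSolution.continuousOn (hφ : IsForwardSolution f φ) :
    ContinuousOn φ (Set.Ici 0) :=
  IsIntegralCurveOn.continuousOn hφ

/-- If `V̇ ≤ -c` at every point of a forward solution `φ`, then `V (φ t) + c t` is
nonincreasing. -/
theorem IsForwardSolution.antitoneOn_add_mul (hφ : IsForwardSolution f φ)
    (hV : Differentiable ℝ V) {c : ℝ} (hc : ∀ t, 0 ≤ t → fderiv ℝ V (φ t) (f (φ t)) ≤ -c) :
    AntitoneOn (fun t => V (φ t) + c * t) (Set.Ici 0) := by
  refine antitoneOn_of_hasDerivWithinAt_nonpos (convex_Ici 0)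
    (f' := fun t => fderiv ℝ V (φ t) (f (φ t)) + c) ?_ ?_ ?_
  · exact (hV.continuous.comp_continuousOn hφ.continuousOn).add (by fun_prop)
  · intro t ht
    have ht' : t ∈ Set.Ici (0 : ℝ) := interior_subset ht
    have h1 : HasDerivWithinAt (V ∘ φ) (fderiv ℝ V (φ t) (f (φ t))) (interior (Set.Ici 0)) t :=
      (hV (φ t)).hasFDerivAt.comp_hasDerivWithinAt t ((hφ t ht').mono interior_subset)
    have h2 : HasDerivWithinAt (fun t : ℝ => c * t) c (interior (Set.Ici 0)) t := by
      simpa using ((hasDerivAt_id t).const_mul c).hasDerivWithinAt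
    exact h1.add h2
  · intro t ht
    have := hc t (interior_subset ht)
    linarith

theorem IsForwardSolution.antitoneOn (hφ : IsForwardSolution f φ) (hV : Differentiable ℝ V)
    (hc : ∀ t, 0 ≤ t → fderiv ℝ V (φ t) (f (φ t)) ≤ 0) :
    AntitoneOn (fun t => V (φ t)) (Set.Ici 0) := by
  simpa using hφ.antitoneOn_add_mul hV (c := 0) (by simpa using hc)

variable [FiniteDimensional ℝ E]

theorem isCompact_sublevel (hV : Continuous V) (hVtop : Tendsto V (Bornology.cobounded E) atTop)
    (c : ℝ) : IsCompact {x | V x ≤ c} := by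
  have := FiniteDimensional.proper_real E
  refine Metric.isCompact_of_isClosed_isBounded (isClosed_le hV continuous_const) ?_
  have h := hVtop.eventually (eventually_gt_atTop c)
  rw [← Bornology.isCobounded_compl_iff]
  exact mem_of_superset h fun x hx => by simpa using hx

/-- A positive definite, radially unbounded function that does not increase along the field keeps
solutions in compact sets. Cutting the field off outside a large ball makes it bounded and
Lipschitz, and the cut-off field has the same sign of `V̇`, so its global solution never leaves the
region in which the field is unchanged. -/
theorem exists_isForwardSolution_of_lyapunov (hf : ContDiff ℝ 1 f) (hV : Differentiable ℝ V)
    (hVtop : Tendsto V (Bornology.cobounded E) atTop)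
    (hdec : ∀ x, fderiv ℝ V x (f x) ≤ 0) (x₀ : E) :
    ∃ φ : ℝ → E, IsForwardSolution f φ ∧ φ 0 = x₀ := by
  have hcpt := isCompact_sublevel hV.continuous hVtop (V x₀)
  obtain ⟨R, hR0, hR⟩ := hcpt.isBounded.subset_closedBall_lt 0 0
  let χ : ContDiffBump (0 : E) := ⟨R, R + 1, hR0, by linarith⟩
  let g : E → E := fun x => χ x • f x
  have hg : ContDiff ℝ 1 g := χ.contDiff.smul hf
  have hgs : HasCompactSupport g := χ.hasCompactSupport.smul_right
  obtain ⟨K, hK⟩ := hg.lipschitzWith_of_hasCompactSupport hgs one_ne_zero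
  obtain ⟨L, hL⟩ := hgs.exists_bound_of_continuous hg.continuous
  have := FiniteDimensional.complete ℝ E
  obtain ⟨φ, hφ, hφ0⟩ := exists_isForwardSolution_of_bounded_lipschitz hK hL x₀
  have hanti : AntitoneOn (fun t => V (φ t)) (Set.Ici 0) := by
    refine hφ.antitoneOn hV fun t _ => ?_
    simp only [g, map_smul, smul_eq_mul]
    exact mul_nonpos_of_nonneg_of_nonpos χ.nonneg (hdec _)
  refine ⟨φ, fun t ht => ?_, hφ0⟩
  have hle : V (φ t) ≤ V x₀ := hφ0 ▸ hanti (Set.mem_Ici.2 le_rfl) ht ht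
  have hone : χ (φ t) = 1 := χ.one_of_mem_closedBall (hR hle)
  simpa [g, hone] using hφ t ht

/-- **Lyapunov's theorem**, global version: a positive definite, radially unbounded `V` with
negative definite derivative along a `C¹` field makes the origin globally asymptotically stable,
solutions on `[0, ∞)` included. -/
theorem isGloballyAsymptoticallyStable_of_lyapunov (hf : ContDiff ℝ 1 f) (hf0 : f 0 = 0)
    (hV : Differentiable ℝ V) (hV0 : V 0 = 0) (hVpos : ∀ x, x ≠ 0 → 0 < V x)
    (hVtop : Tendsto V (Bornology.cobounded E) atTop) {l : E → ℝ} (hl : Continuous l)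
    (hl0 : 0 ≤ l 0) (hlpos : ∀ x, x ≠ 0 → 0 < l x)
    (hdec : ∀ x, fderiv ℝ V x (f x) ≤ -l x) :
    IsGloballyAsymptoticallyStable f := by
  have hdec0 : ∀ x, fderiv ℝ V x (f x) ≤ 0 := by
    intro x
    have hlx : 0 ≤ l x := by
      rcases eq_or_ne x 0 with rfl | hx
      exacts [hl0, (hlpos x hx).le]
    linarith [hdec x]
  have hVnn : ∀ x, 0 ≤ V x := by
    intro x
    rcases eq_or_ne x 0 with rfl | hx
    exacts [hV0.ge, (hVpos x hx).le]
  have hcpt := isCompact_sublevel hV.continuous hVtop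
  have hanti : ∀ φ : ℝ → E, IsForwardSolution f φ → AntitoneOn (fun t => V (φ t)) (Set.Ici 0) :=
    fun φ hφ => hφ.antitoneOn hV fun t _ => hdec0 _
  -- `V` is bounded below by a positive constant away from the origin.
  have hlow : ∀ ε > 0, ∃ c > 0, ∀ x, V x < c → ‖x‖ < ε := by
    intro ε hε
    have hK : IsCompact ({x | V x ≤ 1} ∩ {x | ε ≤ ‖x‖}) :=
      (hcpt 1).inter_right (isClosed_le continuous_const continuous_norm)
    rcases ({x | V x ≤ 1} ∩ {x | ε ≤ ‖x‖}).eq_empty_or_nonempty with h | h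
    · refine ⟨1, one_pos, fun x hx => ?_⟩
      by_contra hx'
      exact (h ▸ (⟨hx.le, not_lt.1 hx'⟩ : x ∈ {x | V x ≤ 1} ∩ {x | ε ≤ ‖x‖}) : x ∈ (∅ : Set E))
    · obtain ⟨z, hz, hmin⟩ := hK.exists_isMinOn h hV.continuous.continuousOn
      have hz0 : z ≠ 0 := by
        rintro rfl
        have : ε ≤ ‖(0 : E)‖ := hz.2
        rw [norm_zero] at this
        linarith
      refine ⟨V z, hVpos z hz0, fun x hx => ?_⟩
      by_contra hx'
      have hx1 : V x ≤ 1 := hx.le.trans hz.1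
      have : V z ≤ V x := hmin ⟨hx1, not_lt.1 hx'⟩
      linarith
  refine ⟨hf0, exists_isForwardSolution_of_lyapunov hf hV hVtop hdec0, ?_, ?_⟩
  · intro ε hε
    obtain ⟨c, hc, hcε⟩ := hlow ε hε
    have hnear : ∀ᶠ x in 𝓝 (0 : E), V x < c :=
      hV.continuous.continuousAt.eventually_lt continuousAt_const (by rw [hV0]; exact hc)
    obtain ⟨δ, hδ, hball⟩ := Metric.eventually_nhds_iff.1 hnear
    refine ⟨δ, hδ, fun φ hφ h0 t ht => hcε _ ?_⟩
    exact (hanti φ hφ (Set.mem_Ici.2 le_rfl) ht ht).trans_lt (hball (by simpa using h0))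
  · intro φ hφ
    rw [Metric.tendsto_atTop]
    intro ε hε
    obtain ⟨c, hc, hcε⟩ := hlow ε hε
    -- If `V ∘ φ` stayed above `c`, then `l` would be bounded below along the solution, and
    -- `V ∘ φ` would become negative.
    obtain ⟨s, hs, hsc⟩ : ∃ s, 0 ≤ s ∧ V (φ s) < c := by
      by_contra! hcon
      have hK : IsCompact ({x | V x ≤ V (φ 0)} ∩ {x | c ≤ V x}) :=
        (hcpt _).inter_right (isClosed_le continuous_const hV.continuous)
      have hmem : ∀ t, 0 ≤ t → φ t ∈ {x | V x ≤ V (φ 0)} ∩ {x | c ≤ V x} := fun t ht =>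
        ⟨hanti φ hφ (Set.mem_Ici.2 le_rfl) ht ht, hcon t ht⟩
      obtain ⟨z, hz, hmin⟩ := hK.exists_isMinOn ⟨_, hmem 0 le_rfl⟩ hl.continuousOn
      have hz0 : z ≠ 0 := by
        rintro rfl
        have : c ≤ V 0 := hz.2
        linarith
      have hlz := hlpos z hz0
      have hmono := hφ.antitoneOn_add_mul hV (c := l z) fun t ht =>
        (hdec _).trans (neg_le_neg (hmin (hmem t ht)))
      have htime : 0 ≤ (V (φ 0) + 1) / l z :=
        div_nonneg (by linarith [hVnn (φ 0)]) hlz.le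
      have h := hmono (Set.mem_Ici.2 le_rfl) htime htime
      simp only [mul_div_cancel₀ _ hlz.ne', mul_zero, add_zero] at h
      linarith [hVnn (φ ((V (φ 0) + 1) / l z))]
    refine ⟨s, fun t ht => ?_⟩
    rw [dist_zero_right]
    exact hcε _ ((hanti φ hφ hs (hs.trans ht) ht).trans_lt hsc)

end Lyapunov

/-! ### Polynomials as functions -/

theorem hasFDerivAt_eval {n : ℕ} (p : RPoly n) (x : EuclideanSpace ℝ (Fin n)) :
    HasFDerivAt (fun z : EuclideanSpace ℝ (Fin n) => eval z.ofLp p)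
      (∑ i, eval x.ofLp (pderiv i p) • (EuclideanSpace.proj i : EuclideanSpace ℝ (Fin n) →L[ℝ] ℝ))
      x := by
  induction p using MvPolynomial.induction_on with
  | C a => simpa using hasFDerivAt_const a x
  | add p q hp hq =>
    simp only [map_add]
    refine (hp.add hq).congr_fderiv ?_
    simp [add_smul, Finset.sum_add_distrib]
  | mul_X p j hp =>
    have hX : HasFDerivAt (fun z : EuclideanSpace ℝ (Fin n) => z.ofLp j)
        (EuclideanSpace.proj j : EuclideanSpace ℝ (Fin n) →L[ℝ] ℝ) x :=
      (EuclideanSpace.proj j : EuclideanSpace ℝ (Fin n) →L[ℝ] ℝ).hasFDerivAt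
    have h := hp.mul hX
    simp only [map_mul, eval_X]
    refine h.congr_fderiv ?_
    ext v
    have hsum : ∑ i, eval x.ofLp p * eval x.ofLp (pderiv i (X j)) * v.ofLp i =
        eval x.ofLp p * v.ofLp j := by
      simp [pderiv_X, Pi.single_apply, apply_ite (eval x.ofLp)]
    rw [← sub_eq_zero]
    simp [Derivation.leibniz, add_mul, Finset.sum_add_distrib, Finset.mul_sum, ← hsum, mul_assoc]

theorem fderiv_eval {n : ℕ} (p : RPoly n) (x v : EuclideanSpace ℝ (Fin n)) :
    fderiv ℝ (fun z : EuclideanSpace ℝ (Fin n) => eval z.ofLp p) x v =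
      evalVec x.ofLp (gradPoly p) ⬝ᵥ v.ofLp := by
  rw [(hasFDerivAt_eval p x).fderiv]
  simp [evalVec, gradPoly, dotProduct]

theorem contDiff_eval {n : ℕ} (p : RPoly n) :
    ContDiff ℝ 1 (fun z : EuclideanSpace ℝ (Fin n) => eval z.ofLp p) := by
  induction p using MvPolynomial.induction_on with
  | C a => simpa using contDiff_const
  | add p q hp hq => simpa using hp.add hq
  | mul_X p j hp =>
    have hX : ContDiff ℝ 1 (fun z : EuclideanSpace ℝ (Fin n) => z.ofLp j) :=
      (EuclideanSpace.proj j : EuclideanSpace ℝ (Fin n) →L[ℝ] ℝ).contDiff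
    simpa using hp.mul hX

theorem contDiff_closedLoop {n m N M : ℕ} (Z : Fin N → RPoly n)
    (W : Matrix (Fin M) (Fin m) (RPoly n)) (k : Fin m → RPoly n)
    (A : Matrix (Fin n) (Fin N) ℝ) (B : Matrix (Fin n) (Fin M) ℝ) :
    ContDiff ℝ 1 (closedLoop Z W k A B) := by
  rw [contDiff_euclidean]
  intro i
  simp only [closedLoop, Pi.add_apply, mulVec, dotProduct, evalVec, evalMat, map_apply]
  have := fun p : RPoly n => contDiff_eval p
  fun_prop

/-- A polynomial that is minimal at the origin has a vanishing gradient there. -/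
theorem evalVec_gradPoly_zero_of_nonneg {n : ℕ} {p : RPoly n} (h0 : eval 0 p = 0)
    (hp : ∀ x, 0 ≤ eval x p) : evalVec 0 (gradPoly p) = 0 := by
  have hmin : IsLocalMin (fun z : EuclideanSpace ℝ (Fin n) => eval z.ofLp p) 0 :=
    Eventually.of_forall fun z => by
      simpa only [WithLp.ofLp_zero, h0] using hp z.ofLp
  have hd := hmin.fderiv_eq_zero
  ext i
  have := fderiv_eval p 0 (EuclideanSpace.single i 1)
  rw [hd] at this
  simpa using this.symm

theorem IsRadiallyUnbounded.tendsto_of_le {n : ℕ} {p r : RPoly n} (hp : IsRadiallyUnbounded p)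
    (h : ∀ x, eval x p ≤ eval x r) :
    Tendsto (fun x : EuclideanSpace ℝ (Fin n) => eval x.ofLp r) (Bornology.cobounded _) atTop := by
  rw [← comap_norm_atTop]
  exact tendsto_atTop_mono (fun x => h x.ofLp) hp

theorem eval_nonneg_of_isSumSq {n : ℕ} {p : RPoly n} (hp : IsSumSq p) (x : Fin n → ℝ) :
    0 ≤ eval x p := by
  induction hp with
  | zero => simp
  | sq_add a _ ih =>
    rw [map_add, map_mul]
    exact add_nonneg (mul_self_nonneg _) ih

theorem posSemidef_map_eval_of_isSOSMatrix {n : ℕ} {ι : Type*} [Fintype ι]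
    [DecidableEq ι]
    {P : Matrix ι ι (RPoly n)} (hP : IsSOSMatrix P) (x : Fin n → ℝ) :
    (P.map (eval x)).PosSemidef := by
  obtain ⟨s, F, rfl⟩ := hP
  have h : (∑ i, (F i)ᵀ * F i).map (eval x) =
      ∑ i, ((F i).map (eval x))ᴴ * (F i).map (eval x) := by
    simp only [conjTranspose_eq_transpose_of_trivial, ← transpose_map, ← Matrix.map_mul]
    exact map_sum (eval x).mapMatrix _ _
  rw [h]
  exact posSemidef_sum _ fun i _ => posSemidef_conjTranspose_mul_self _

/-! ### The matrix ellipsoid of consistent systems -/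

/-- Completing the square: `(A, B)` explains the data with the disturbance
`D = X₁ - A Z₀ - B V₀`, and `Q̃` exceeds the `Ã`-weighted square of the distance to the centre
exactly by `ΔΔᵀ - DDᵀ`. In particular `Q̃` is positive semidefinite as soon as the data are
consistent with some system. -/
theorem matQ_eq_add {n N M T q : ℕ} {X1 : Matrix (Fin n) (Fin T) ℝ}
    {Z0 : Matrix (Fin N) (Fin T) ℝ} {V0 : Matrix (Fin M) (Fin T) ℝ} {Δ : Matrix (Fin n) (Fin q) ℝ}
    (hA : IsUnit (matA Z0 V0).det) {A : Matrix (Fin n) (Fin N) ℝ} {B : Matrix (Fin n) (Fin M) ℝ}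
    {D : Matrix (Fin n) (Fin T) ℝ} (hX : X1 = A * Z0 + B * V0 + D) :
    matQ X1 Z0 V0 Δ =
      ((fromCols A B)ᵀ - matZc X1 Z0 V0)ᵀ * matA Z0 V0 * ((fromCols A B)ᵀ - matZc X1 Z0 V0) +
        (Δ * Δᵀ - D * Dᵀ) := by
  have hD : D = X1 - fromCols A B * fromRows Z0 V0 := by
    rw [fromCols_mul_fromRows, hX]; abel
  have hsymm : (matA Z0 V0)ᵀ = matA Z0 V0 := by
    rw [matA, transpose_mul, transpose_transpose]
  have hinv : ((matA Z0 V0)⁻¹)ᵀ = (matA Z0 V0)⁻¹ := by rw [transpose_nonsing_inv, hsymm]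
  have h1 : matA Z0 V0 * (matA Z0 V0)⁻¹ = 1 := mul_nonsing_inv _ hA
  have h2 : (matA Z0 V0)⁻¹ * matA Z0 V0 = 1 := nonsing_inv_mul _ hA
  have hdef : matA Z0 V0 = fromRows Z0 V0 * (fromRows Z0 V0)ᵀ := rfl
  simp only [matQ, matZc, matB, matC]
  rw [hD]
  generalize fromRows Z0 V0 = R at *
  generalize fromCols A B = P at *
  generalize matA Z0 V0 = G at *
  have e1 : (Pᵀ - -(G⁻¹ * -(R * X1ᵀ)))ᵀ * G = P * G - X1 * Rᵀ := by
    simp only [transpose_sub, transpose_mul, transpose_transpose, hinv, Matrix.sub_mul,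
      Matrix.mul_neg, neg_neg, Matrix.mul_assoc, h2, Matrix.mul_one]
  rw [e1]
  have e2 : P * G * (G⁻¹ * (R * X1ᵀ)) = P * (R * X1ᵀ) := by
    rw [Matrix.mul_assoc, ← Matrix.mul_assoc G, h1, Matrix.one_mul]
  simp only [Matrix.mul_neg, neg_neg, Matrix.mul_sub, Matrix.sub_mul, e2, transpose_neg,
    transpose_mul, transpose_transpose, transpose_sub, Matrix.neg_mul]
  rw [hdef]
  simp only [Matrix.mul_assoc]
  abel

theorem posDef_matA {N M T : ℕ} {Z0 : Matrix (Fin N) (Fin T) ℝ} {V0 : Matrix (Fin M) (Fin T) ℝ}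
    (hrank : (fromRows Z0 V0).rank = N + M) : (matA Z0 V0).PosDef := by
  have hps : (matA Z0 V0).PosSemidef := by
    simpa [matA] using posSemidef_self_mul_conjTranspose (fromRows Z0 V0)
  rw [hps.posDef_iff_isUnit]
  have hr : (matA Z0 V0).rank = Fintype.card (Fin N ⊕ Fin M) := by
    rw [matA, rank_self_mul_transpose, hrank, Fintype.card_sum, Fintype.card_fin, Fintype.card_fin]
  rw [← linearIndependent_rows_iff_isUnit, linearIndependent_iff_card_eq_finrank_span, ← hr,
    rank_eq_finrank_span_row]
  rfl

theorem sqrt_transpose {ι : Type*} [Fintype ι] [DecidableEq ι] (G : Matrix ι ι ℝ) :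
    (CFC.sqrt G)ᵀ = CFC.sqrt G := by
  have := (nonneg_iff_posSemidef.1 (CFC.sqrt_nonneg G)).isHermitian
  simpa [IsHermitian] using this

theorem isUnit_det_matA {N M T : ℕ} {Z0 : Matrix (Fin N) (Fin T) ℝ}
    {V0 : Matrix (Fin M) (Fin T) ℝ} (hrank : (fromRows Z0 V0).rank = N + M) :
    IsUnit (matA Z0 V0).det :=
  (isUnit_iff_isUnit_det _).1 (posDef_matA hrank).isUnit

theorem matAinvSqrt_mul_self {N M T : ℕ} {Z0 : Matrix (Fin N) (Fin T) ℝ}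
    {V0 : Matrix (Fin M) (Fin T) ℝ} (hrank : (fromRows Z0 V0).rank = N + M) :
    matAinvSqrt Z0 V0 * matAinvSqrt Z0 V0 = (matA Z0 V0)⁻¹ :=
  CFC.sqrt_mul_sqrt_self _ (posDef_matA hrank).inv.posSemidef.nonneg

/-- `Ã^{-1/2}` is injective. -/
theorem eq_zero_of_matAinvSqrt_mulVec_eq_zero {N M T : ℕ} {Z0 : Matrix (Fin N) (Fin T) ℝ}
    {V0 : Matrix (Fin M) (Fin T) ℝ} (hrank : (fromRows Z0 V0).rank = N + M)
    {y : Fin N ⊕ Fin M → ℝ} (hy : matAinvSqrt Z0 V0 *ᵥ y = 0) : y = 0 := by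
  have h : (matA Z0 V0)⁻¹ *ᵥ y = 0 := by
    rw [← matAinvSqrt_mul_self hrank, ← mulVec_mulVec, hy, mulVec_zero]
  have h' := congrArg (matA Z0 V0 *ᵥ ·) h
  simpa [mulVec_mulVec, mul_nonsing_inv _ (isUnit_det_matA hrank)] using h'

/-! ### The decrease matrix -/

theorem replicateCol_mulVec_one {κ : Type*} (v : κ → ℝ) :
    (replicateCol Unit v *ᵥ fun _ => (1 : ℝ)) = v := by
  ext i; simp [mulVec, dotProduct]

/-- The scalar inequality obtained by taking the Schur complement of a negative semidefinite
decrease matrix: its quadratic form is evaluated at the maximiser `(1, Ah y / μ, Qh g / 4)` over the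
last two blocks. -/
theorem add_le_zero_of_decreaseBlock {ι κ : Type*} [Fintype ι] [DecidableEq ι] [Fintype κ]
    [DecidableEq κ] {Ah : Matrix κ κ ℝ} {Qh : Matrix ι ι ℝ} {Zc : Matrix κ ι ℝ}
    {l μ : ℝ} {g : ι → ℝ} {y : κ → ℝ} (hμ : 0 < μ)
    (h : (-(decreaseBlock Ah Qh Zc l μ g y)).PosSemidef) :
    l + g ⬝ᵥ (Zcᵀ *ᵥ y) + (Ah *ᵥ y ⬝ᵥ Ah *ᵥ y) / μ + μ / 4 * (Qh *ᵥ g ⬝ᵥ Qh *ᵥ g) ≤ 0 := by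
  have h0 := h.dotProduct_mulVec_nonneg
    (Sum.elim (fun _ => (1 : ℝ)) (Sum.elim (μ⁻¹ • (Ah *ᵥ y)) ((1 / 4 : ℝ) • (Qh *ᵥ g))))
  generalize hc : l + g ⬝ᵥ (Zcᵀ *ᵥ y) = c at *
  have key : Sum.elim (fun _ => (1 : ℝ)) (Sum.elim (μ⁻¹ • (Ah *ᵥ y)) ((1 / 4 : ℝ) • (Qh *ᵥ g))) ⬝ᵥ
      decreaseBlock Ah Qh Zc l μ g y *ᵥ
      Sum.elim (fun _ => (1 : ℝ)) (Sum.elim (μ⁻¹ • (Ah *ᵥ y)) ((1 / 4 : ℝ) • (Qh *ᵥ g))) =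
      c + (Ah *ᵥ y ⬝ᵥ Ah *ᵥ y) / μ + μ / 4 * (Qh *ᵥ g ⬝ᵥ Qh *ᵥ g) := by
    simp only [decreaseBlock, hc]
    generalize Ah *ᵥ y = a
    generalize Qh *ᵥ g = b
    have hc1 : (Matrix.of (fun _ _ : Unit => c) *ᵥ fun _ => (1 : ℝ)) = fun _ => c := by
      ext i; simp [mulVec, dotProduct]
    simp only [fromBlocks_mulVec, Sum.elim_comp_inl, Sum.elim_comp_inr, sumElim_dotProduct_sumElim,
      transpose_fromRows, fromCols_mulVec, fromRows_mulVec, replicateCol_mulVec_one, neg_mulVec,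
      smul_mulVec, one_mulVec, zero_mulVec, transpose_replicateCol,
      replicateRow_mulVec_eq_const, hc1]
    simp
    field_simp
    ring
  simp only [star_trivial, neg_mulVec, dotProduct_neg, key] at h0
  linarith

/-- Young's inequality for `gᵀ Eᵀ y = (Ah G E g)ᵀ (Ah y)`, where `Ah = G^{-1/2}`, combined with the
matrix bound `Eᵀ G E ≼ Q = Qh²`. It absorbs the model uncertainty `E`. -/
theorem dotProduct_transpose_mulVec_le {ι κ : Type*} [Fintype ι] [Fintype κ] [DecidableEq κ]
    {G Ah : Matrix κ κ ℝ} {Q Qh : Matrix ι ι ℝ} {E : Matrix κ ι ℝ}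
    (hG : IsUnit G.det) (hGs : Gᵀ = G) (hAh : Ahᵀ = Ah) (hAh2 : Ah * Ah = G⁻¹)
    (hQh : Qhᵀ = Qh) (hQh2 : Qh * Qh = Q) (hE : (Q - Eᵀ * G * E).PosSemidef)
    {μ : ℝ} (hμ : 0 < μ) (g : ι → ℝ) (y : κ → ℝ) :
    g ⬝ᵥ (Eᵀ *ᵥ y) ≤ (Ah *ᵥ y ⬝ᵥ Ah *ᵥ y) / μ + μ / 4 * (Qh *ᵥ g ⬝ᵥ Qh *ᵥ g) := by
  set w : κ → ℝ := Ah *ᵥ (G *ᵥ (E *ᵥ g)) with hw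
  have e1 : w ⬝ᵥ Ah *ᵥ y = g ⬝ᵥ (Eᵀ *ᵥ y) := by
    have hP : (Ah * (G * E))ᵀ * Ah = Eᵀ := by
      rw [transpose_mul, transpose_mul, hGs, hAh, Matrix.mul_assoc, hAh2, Matrix.mul_assoc,
        mul_nonsing_inv _ hG, Matrix.mul_one]
    rw [← hP, ← mulVec_mulVec, dotProduct_mulVec g, vecMul_transpose, hw, mulVec_mulVec,
      mulVec_mulVec, Matrix.mul_assoc]
  have e2 : w ⬝ᵥ w = g ⬝ᵥ ((Eᵀ * G * E) *ᵥ g) := by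
    have hP : (Ah * (G * E))ᵀ * (Ah * (G * E)) = Eᵀ * G * E := by
      rw [transpose_mul, transpose_mul, hGs, hAh, Matrix.mul_assoc, ← Matrix.mul_assoc Ah, hAh2,
        ← Matrix.mul_assoc G⁻¹, nonsing_inv_mul _ hG, Matrix.one_mul, Matrix.mul_assoc]
    rw [← hP, ← mulVec_mulVec, dotProduct_mulVec g, vecMul_transpose, hw, mulVec_mulVec,
      mulVec_mulVec, Matrix.mul_assoc]
  have e3 : Qh *ᵥ g ⬝ᵥ Qh *ᵥ g = g ⬝ᵥ (Q *ᵥ g) := by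
    rw [← hQh2, ← mulVec_mulVec, dotProduct_mulVec g, ← mulVec_transpose, hQh]
  have h1 : w ⬝ᵥ w ≤ Qh *ᵥ g ⬝ᵥ Qh *ᵥ g := by
    have := hE.dotProduct_mulVec_nonneg g
    rw [star_trivial, sub_mulVec, dotProduct_sub] at this
    rw [e2, e3]
    linarith
  have h2 : 0 ≤ (Ah *ᵥ y - (μ / 2) • w) ⬝ᵥ (Ah *ᵥ y - (μ / 2) • w) := by
    simpa using dotProduct_star_self_nonneg (Ah *ᵥ y - (μ / 2) • w)
  simp only [sub_dotProduct, dotProduct_sub, smul_dotProduct, dotProduct_smul, smul_eq_mul,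
    dotProduct_comm (Ah *ᵥ y) w, e1] at h2
  have h3 : g ⬝ᵥ (Eᵀ *ᵥ y) ≤ (Ah *ᵥ y ⬝ᵥ Ah *ᵥ y) / μ + μ / 4 * (w ⬝ᵥ w) := by
    rw [← sub_nonneg]
    have : (Ah *ᵥ y ⬝ᵥ Ah *ᵥ y) / μ + μ / 4 * (w ⬝ᵥ w) - g ⬝ᵥ (Eᵀ *ᵥ y) =
      (Ah *ᵥ y ⬝ᵥ Ah *ᵥ y - μ / 2 * g ⬝ᵥ (Eᵀ *ᵥ y) -
        (μ / 2 * g ⬝ᵥ (Eᵀ *ᵥ y) - μ / 2 * (μ / 2 * (w ⬝ᵥ w)))) / μ := by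
      field_simp
      ring
    rw [this]
    exact div_nonneg (by linarith) hμ.le
  have h4 := mul_le_mul_of_nonneg_left h1 (by positivity : 0 ≤ μ / 4)
  linarith

theorem map_decreasePoly {n m N M : ℕ} (Ah : Matrix (Fin N ⊕ Fin M) (Fin N ⊕ Fin M) ℝ)
    (Qh : Matrix (Fin n) (Fin n) ℝ) (Zc : Matrix (Fin N ⊕ Fin M) (Fin n) ℝ)
    (Z : Fin N → RPoly n) (W : Matrix (Fin M) (Fin m) (RPoly n))
    (l V lam : RPoly n) (k : Fin m → RPoly n) (x : Fin n → ℝ) :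
    (decreasePoly Ah Qh Zc Z W l V lam k).map (eval x) =
      decreaseAt Ah Qh Zc Z W l V lam k x := by
  have hy : (fun i => eval x (Sum.elim Z (W *ᵥ k) i)) =
      Sum.elim (evalVec x Z) (evalMat x W *ᵥ evalVec x k) := by
    ext (i | i)
    · rfl
    · exact RingHom.map_mulVec (eval x) W k i
  have hA : ∀ i, eval x ((Ah.map C *ᵥ Sum.elim Z (W *ᵥ k)) i) =
      (Ah *ᵥ Sum.elim (evalVec x Z) (evalMat x W *ᵥ evalVec x k)) i := by
    intro i
    rw [RingHom.map_mulVec, ← hy]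
    congr 2
    ext; simp
  have hQ : ∀ i, eval x ((Qh.map C *ᵥ gradPoly V) i) = (Qh *ᵥ evalVec x (gradPoly V)) i := by
    intro i
    rw [RingHom.map_mulVec]
    congr 2
    ext; simp
  have hZ : eval x (gradPoly V ⬝ᵥ ((Zc.map C)ᵀ *ᵥ Sum.elim Z (W *ᵥ k))) =
      evalVec x (gradPoly V) ⬝ᵥ
        (Zcᵀ *ᵥ Sum.elim (evalVec x Z) (evalMat x W *ᵥ evalVec x k)) := by
    rw [RingHom.map_dotProduct]
    congr 1
    ext i
    simp only [Function.comp_apply]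
    rw [RingHom.map_mulVec, ← hy]
    congr 2
    ext; simp
  ext (i | i | i) (j | j | j) <;>
    simp [decreasePoly, decreaseAt, decreaseBlock, hA, hQ, hZ, one_apply, apply_ite (eval x),
      mul_ite]

/-! ### Robust decrease and the data -/

/-- The robust decrease condition: a negative semidefinite decrease matrix bounds `V̇` by `-l`
for every system consistent with the data. -/
theorem decrease_of_mem_consistentSet {n N M T q : ℕ} {X1 : Matrix (Fin n) (Fin T) ℝ}
    {Z0 : Matrix (Fin N) (Fin T) ℝ} {V0 : Matrix (Fin M) (Fin T) ℝ} {Δ : Matrix (Fin n) (Fin q) ℝ}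
    (hrank : (fromRows Z0 V0).rank = N + M)
    {A : Matrix (Fin n) (Fin N) ℝ} {B : Matrix (Fin n) (Fin M) ℝ}
    (hAB : (A, B) ∈ consistentSet X1 Z0 V0 Δ) {l μ : ℝ} (hμ : 0 < μ)
    {g : Fin n → ℝ} {z : Fin N → ℝ} {w : Fin M → ℝ}
    (h : (-(decreaseBlock (matAinvSqrt Z0 V0) (matQSqrt X1 Z0 V0 Δ) (matZc X1 Z0 V0) l μ g
      (Sum.elim z w))).PosSemidef) :
    g ⬝ᵥ (A *ᵥ z + B *ᵥ w) ≤ -l := by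
  obtain ⟨D, hD, hX⟩ := hAB
  have hA := isUnit_det_matA hrank
  have hQ := matQ_eq_add (Δ := Δ) hA hX
  have hDps : (Δ * Δᵀ - D * Dᵀ).PosSemidef := hD
  have hAps := (posDef_matA hrank).posSemidef
  set E := (fromCols A B)ᵀ - matZc X1 Z0 V0 with hE
  have hQps : (matQ X1 Z0 V0 Δ).PosSemidef := by
    rw [hQ]
    refine PosSemidef.add ?_ hDps
    simpa using hAps.conjTranspose_mul_mul_same E
  have h1 := add_le_zero_of_decreaseBlock hμ h
  have h2 := dotProduct_transpose_mulVec_le (G := matA Z0 V0) (Ah := matAinvSqrt Z0 V0)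
    (Q := matQ X1 Z0 V0 Δ) (Qh := matQSqrt X1 Z0 V0 Δ) (E := E) hA
    (by simpa [IsHermitian] using hAps.isHermitian) (sqrt_transpose _)
    (matAinvSqrt_mul_self hrank) (sqrt_transpose _)
    (CFC.sqrt_mul_sqrt_self _ hQps.nonneg) (by rw [hQ]; simpa using hDps) hμ g (Sum.elim z w)
  have h3 : A *ᵥ z + B *ᵥ w =
      (matZc X1 Z0 V0)ᵀ *ᵥ Sum.elim z w + Eᵀ *ᵥ Sum.elim z w := by
    rw [← add_mulVec, hE, transpose_sub, transpose_transpose, add_sub_cancel,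
      fromCols_mulVec_sumElim]
  rw [h3, dotProduct_add]
  linarith

/-- Where the gradient and the decrease rate vanish, the diagonal entry of the decrease matrix is
zero, which forces the off-diagonal entry `Ã^{-1/2} y`, hence `y`, to vanish. -/
theorem regressor_eq_zero {n N M T q : ℕ} {X1 : Matrix (Fin n) (Fin T) ℝ}
    {Z0 : Matrix (Fin N) (Fin T) ℝ} {V0 : Matrix (Fin M) (Fin T) ℝ} {Δ : Matrix (Fin n) (Fin q) ℝ}
    (hrank : (fromRows Z0 V0).rank = N + M) {μ : ℝ} (hμ : 0 < μ) {y : Fin N ⊕ Fin M → ℝ}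
    (h : (-(decreaseBlock (matAinvSqrt Z0 V0) (matQSqrt X1 Z0 V0 Δ) (matZc X1 Z0 V0) 0 μ 0
      y)).PosSemidef) : y = 0 := by
  have h1 := add_le_zero_of_decreaseBlock hμ h
  simp only [zero_dotProduct, mulVec_zero, mul_zero, add_zero, zero_add] at h1
  have h2 : 0 ≤ matAinvSqrt Z0 V0 *ᵥ y ⬝ᵥ matAinvSqrt Z0 V0 *ᵥ y := by
    simpa using dotProduct_star_self_nonneg (matAinvSqrt Z0 V0 *ᵥ y)
  have h3 : matAinvSqrt Z0 V0 *ᵥ y ⬝ᵥ matAinvSqrt Z0 V0 *ᵥ y ≤ 0 := by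
    rwa [div_le_iff₀ hμ, zero_mul] at h1
  exact eq_zero_of_matAinvSqrt_mulVec_eq_zero hrank
    (dotProduct_self_eq_zero.1 (le_antisymm h3 h2))

theorem mem_consistentSet_of_data {n m N M T q : ℕ} {Z : Fin N → RPoly n}
    {W : Matrix (Fin M) (Fin m) (RPoly n)} {A : Matrix (Fin n) (Fin N) ℝ}
    {B : Matrix (Fin n) (Fin M) ℝ} {Δ : Matrix (Fin n) (Fin q) ℝ}
    {xs : Fin T → Fin n → ℝ} {us : Fin T → Fin m → ℝ} {dxs ds : Fin T → Fin n → ℝ}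
    (hdata : ∀ t, dxs t =
      A *ᵥ evalVec (xs t) Z + B *ᵥ (evalMat (xs t) W *ᵥ us t) + ds t)
    (hdist : snapshots ds ∈ disturbanceSet T Δ) :
    (A, B) ∈ consistentSet (snapshots dxs) (dataZ Z xs) (dataV W xs us) Δ := by
  refine ⟨snapshots ds, hdist, ?_⟩
  ext i t
  exact congrFun (hdata t) i

theorem theorem3 {n m N M T q : ℕ}
    -- regressors, true system, disturbance bound
    (Z : Fin N → RPoly n) (W : Matrix (Fin M) (Fin m) (RPoly n))
    (Astar : Matrix (Fin n) (Fin N) ℝ) (Bstar : Matrix (Fin n) (Fin M) ℝ)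
    (Δ : Matrix (Fin n) (Fin q) ℝ)
    -- samples of state, input, state derivative and disturbance
    (xs : Fin T → Fin n → ℝ) (us : Fin T → Fin m → ℝ)
    (dxs : Fin T → Fin n → ℝ) (ds : Fin T → Fin n → ℝ)
    (hdata : ∀ t, dxs t =
      Astar *ᵥ evalVec (xs t) Z + Bstar *ᵥ (evalMat (xs t) W *ᵥ us t) + ds t)
    (hdist : snapshots ds ∈ disturbanceSet T Δ)
    (X1 : Matrix (Fin n) (Fin T) ℝ) (hX1 : X1 = snapshots dxs)
    (Z0 : Matrix (Fin N) (Fin T) ℝ) (hZ0 : Z0 = dataZ Z xs)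
    (V0 : Matrix (Fin M) (Fin T) ℝ) (hV0 : V0 = dataV W xs us)
    -- full row rank
    (hrank : (fromRows Z0 V0).rank = N + M)
    -- design parameters
    (l₁ l₂ : RPoly n) (hl₁ : IsPosDefPoly l₁) (hl₂ : IsPosDefPoly l₂)
    (hl₁' : IsRadiallyUnbounded l₁) (ε : ℝ) (hε : 0 < ε)
    -- decision variables and the sum-of-squares program
    (V lam : RPoly n) (k : Fin m → RPoly n)
    (hV : eval 0 V = 0) (hk : evalVec 0 k = 0)
    (hsos₁ : IsSumSq (V - l₁))
    (hsos₂ : IsSOSMatrix (-(decreasePoly (matAinvSqrt Z0 V0) (matQSqrt X1 Z0 V0 Δ)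
      (matZc X1 Z0 V0) Z W l₂ V lam k)))
    (hsos₃ : IsSumSq (lam - C ε)) :
    (∀ x : Fin n → ℝ,
      0 ≤ eval x V - eval x l₁ ∧
      (-(decreaseAt (matAinvSqrt Z0 V0) (matQSqrt X1 Z0 V0 Δ)
        (matZc X1 Z0 V0) Z W l₂ V lam k x)).PosSemidef ∧
      0 < eval x lam) ∧
    (∀ A B, (A, B) ∈ consistentSet X1 Z0 V0 Δ →
      IsGloballyAsymptoticallyStable (closedLoop Z W k A B)) ∧
    (Astar, Bstar) ∈ consistentSet X1 Z0 V0 Δ ∧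
    IsGloballyAsymptoticallyStable (closedLoop Z W k Astar Bstar) := by
  have hVl : ∀ x, 0 ≤ eval x V - eval x l₁ := fun x => by
    simpa using eval_nonneg_of_isSumSq hsos₁ x
  have hlam : ∀ x, 0 < eval x lam := fun x => by
    have := eval_nonneg_of_isSumSq hsos₃ x
    simp only [map_sub, eval_C] at this
    linarith
  have hM : ∀ x, (-(decreaseAt (matAinvSqrt Z0 V0) (matQSqrt X1 Z0 V0 Δ)
      (matZc X1 Z0 V0) Z W l₂ V lam k x)).PosSemidef := fun x => by
    have h := posSemidef_map_eval_of_isSOSMatrix hsos₂ x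
    rwa [Matrix.map_neg _ (map_neg (eval x)), map_decreasePoly] at h
  have hl₁nn : ∀ x, 0 ≤ eval x l₁ := fun x => by
    rcases eq_or_ne x 0 with rfl | hx
    exacts [hl₁.1.ge, (hl₁.2 x hx).le]
  have hgrad : evalVec 0 (gradPoly V) = 0 :=
    evalVec_gradPoly_zero_of_nonneg hV fun x => by linarith [hVl x, hl₁nn x]
  -- `Z` is not assumed to vanish at the origin: this is forced by the decrease matrix at `x = 0`.
  have hy0 : Sum.elim (evalVec 0 Z) (evalMat 0 W *ᵥ evalVec 0 k) = 0 := by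
    have h := hM 0
    rw [decreaseAt, hgrad, hl₂.1] at h
    exact regressor_eq_zero hrank (hlam 0) h
  have hZ : evalVec 0 Z = 0 := funext fun i => congrFun hy0 (Sum.inl i)
  have hGAS : ∀ A B, (A, B) ∈ consistentSet X1 Z0 V0 Δ →
      IsGloballyAsymptoticallyStable (closedLoop Z W k A B) := by
    intro A B hAB
    refine isGloballyAsymptoticallyStable_of_lyapunov (contDiff_closedLoop Z W k A B)
      (V := fun x => eval x.ofLp V) (l := fun x => eval x.ofLp l₂) ?_
      ((contDiff_eval V).differentiable one_ne_zero) hV ?_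
      (hl₁'.tendsto_of_le fun x => sub_nonneg.1 (hVl x)) (contDiff_eval l₂).continuous hl₂.1.ge
      ?_ ?_
    · simp [closedLoop, hZ, hk]
    · intro x hx
      have := hl₁.2 x.ofLp (by simpa using hx)
      linarith [hVl x.ofLp]
    · exact fun x hx => hl₂.2 x.ofLp (by simpa using hx)
    · intro x
      rw [fderiv_eval]
      exact decrease_of_mem_consistentSet hrank hAB (hlam x.ofLp) (hM x.ofLp)
  have hstar : (Astar, Bstar) ∈ consistentSet X1 Z0 V0 Δ := by
    subst hX1 hZ0 hV0
    exact mem_consistentSet_of_data hdata hdist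
  exact ⟨fun x => ⟨hVl x, hM x, hlam x⟩, hGAS, hstar, hGAS _ _ hstar⟩
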